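/- Let $q$ be a prime power and let $K\ge 2$, $0\le T\le K-2$ and $1\le G\le K$ be integers. There are $K$ users and a server. User $k\in[K]=\{1,\dots,K\}$ holds an input $W_k\in\mathbb F_q^{L}$, $L\ge 1$, and for every set $\mathcal G\subseteq[K]$ with $|\mathcal G|=G$ there is a groupwise key $S_{\mathcal G}\in\mathbb F_q^{L_S}$; all symbols of all $W_k$ and all $S_{\mathcal G}$ are i.i.d. uniform on $\mathbb F_q$. User $k$ knows the keys $Z_k=(S_{\mathcal G})_{\mathcal G\ni k}$ and sends to the server a message $X_k\in\mathbb F_q^{L_X}$ that is a function of $(W_k,Z_k)$. Such a scheme is a secure summation scheme if it satisfies - (correctness) $H\big(\sum_{k\in[K]}W_k\,\big|\,(X_k)_{k\in[K]}\big)=0$, and - (security) $I\big((W_k)_{k\in[K]};(X_k)_{k\in[K]}\,\big|\,\sum_{k\in[K]}W_k,(W_k,Z_k)_{k\in\mathcal T}\big)=0$ for every $\mathcal T\subseteq[K]$ with $|\mathcal T|\le T$. A pair $(R,R_S)\in\mathbb R^2$ is achievable if some secure summation scheme (with some $L\ge1$, $L_X$, $L_S$) has $L_X/L\le R$ and $L_S/L\le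 R_S$. Let $\mathcal R_g^*$ be the closure of the set of achievable pairs. Then $$\mathcal R_g^*=\begin{cases}\emptyset & \text{if } G>K-T \text{ or } G=1,\\[2pt] \Big\{(R,R_S): R\ge 1,\ R_S\ge \dfrac{K-T-1}{\binom{K-T}{G}}\Big\} & \text{if } 2\le G\le K-T.\end{cases}$$ -/

import Mathlib

namespace SecureSummation

noncomputable section

/-! ### Shannon entropy of random variables on a finite, uniformly distributed sample space -/

section Entropy

/-- The Shannon entropy, in `q`-ary units, of a distribution on a finite alphabet:
`H(p) = -∑ a, p a * log_q (p a)` (with `0 log 0 = 0`). -/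
def pmfEntropy (q : ℕ) {α : Type*} [Fintype α] (p : PMF α) : ℝ :=
  (∑ a, Real.negMulLog (p a).toReal) / Real.log q

variable {Ω α β γ : Type*} [Fintype Ω] [Nonempty Ω] [Fintype α] [Fintype β] [Fintype γ]

/-- The entropy `H(X)` in `q`-ary units of a random variable `X` defined on the uniform
probability space `Ω`, i.e. the entropy of the law of `X`. -/
def entropy (q : ℕ) (X : Ω → α) : ℝ :=
  pmfEntropy q ((PMF.uniformOfFintype Ω).map X)

/-- The conditional entropy `H(X | Y) = H(X, Y) - H(Y)`. -/
def condEntropy (q : ℕ) (X : Ω → α) (Y : Ω → β) : ℝ :=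
  entropy q (fun ω => (X ω, Y ω)) - entropy q Y

/-- The conditional mutual information `I(X; Y | V) = H(X | V) - H(X | Y, V)`. -/
def condMutualInfo (q : ℕ) (X : Ω → α) (Y : Ω → β) (V : Ω → γ) : ℝ :=
  condEntropy q X V - condEntropy q X (fun ω => (Y ω, V ω))

end Entropy

/-! ### The secure summation problem with symmetric groupwise keys -/

/-- The groups: all subsets of the `K` users with exactly `G` elements. -/
abbrev Group (K G : ℕ) : Type := {A : Finset (Fin K) // A.card = G}

/-- The groups that contain user `k`. -/
abbrev GroupOf (K G : ℕ) (k : Fin K) : Type := {A : Group K G // k ∈ A.1}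

/-- The key variable `Z k` of user `k` takes values in the tuples of groupwise keys
(`LS` symbols each) of all groups that contain `k`. -/
abbrev UserKey (F : Type*) (K G LS : ℕ) (k : Fin K) : Type _ :=
  GroupOf K G k → Fin LS → F

/-- The sample space: one input of `L` symbols for every user and one key of `LS` symbols for
every group. It carries the uniform distribution, so that all the input symbols and all the key
symbols are i.i.d. uniform on `F`. -/
abbrev Sample (F : Type*) (K G L LS : ℕ) : Type _ :=
  (Fin K → Fin L → F) × (Group K G → Fin LS → F)

/-- A scheme: the message of user `k`, made of `LX` symbols, is a function of the input and of
the key variable of user `k`. -/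
abbrev Scheme (F : Type*) (K G L LX LS : ℕ) : Type _ :=
  (k : Fin K) → (Fin L → F) → UserKey F K G LS k → (Fin LX → F)

section Model

variable {F : Type*} {K G L LX LS : ℕ}

/-- The input `W k`. -/
def input (k : Fin K) (ω : Sample F K G L LS) : Fin L → F := ω.1 k

/-- The key variable `Z k`. -/
def userKey (k : Fin K) (ω : Sample F K G L LS) : UserKey F K G LS k := fun A => ω.2 A.1

/-- The message `X k`. -/
def message (c : Scheme F K G L LX LS) (k : Fin K) (ω : Sample F K G L LS) : Fin LX → F :=
  c k (input k ω) (userKey k ω)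

variable [Field F]

/-- The sum of all the inputs. -/
def inputSum (ω : Sample F K G L LS) : Fin L → F := ∑ k, input k ω

variable [Fintype F]

/-- Correctness: `H(∑ W k | (X k)) = 0`. -/
def IsCorrect (c : Scheme F K G L LX LS) : Prop :=
  condEntropy (Fintype.card F) (inputSum : Sample F K G L LS → Fin L → F)
    (fun ω (k : Fin K) => message c k ω) = 0

/-- Security against the server colluding with any set `C` of at most `T` users:
`I((W k); (X k) | ∑ W k, (W k, Z k) for k in C) = 0`. -/
def IsSecure (T : ℕ) (c : Scheme F K G L LX LS) : Prop :=
  ∀ C : Finset (Fin K), C.card ≤ T →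
    condMutualInfo (Fintype.card F)
      (fun (ω : Sample F K G L LS) (k : Fin K) => input k ω)
      (fun ω (k : Fin K) => message c k ω)
      (fun ω => (inputSum ω, fun k : {k // k ∈ C} => (input k.1 ω, userKey k.1 ω))) = 0

end Model

/-- The set of achievable rate pairs `(R, R_S)`: some correct and secure scheme, with inputs of
`L ≥ 1` symbols, has `LX / L ≤ R` and `LS / L ≤ R_S`. -/
def achievable (F : Type*) [Field F] [Fintype F] (K T G : ℕ) : Set (ℝ × ℝ) :=
  {r | ∃ L LX LS : ℕ, 0 < L ∧ ∃ c : Scheme F K G L LX LS, IsCorrect c ∧ IsSecure T c ∧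
    (LX : ℝ) / L ≤ r.1 ∧ (LS : ℝ) / L ≤ r.2}

/-- The optimal rate region: the closure of the set of achievable rate pairs. -/
def optimalRegion (F : Type*) [Field F] [Fintype F] (K T G : ℕ) : Set (ℝ × ℝ) :=
  closure (achievable F K T G)

end

end SecureSummation

/-!
On a uniform finite sample space, a vanishing conditional mutual information `I(X; Y | V)` allows
to change the value of `X` to any other one compatible with `V` without changing `Y` and `V`, and
correctness makes every message injective in the input of its user.

Converse. Let the server collude with all but `n + 1` of the users. For arbitrary inputs of `n` of
the remaining users, completed by the last one to a zero-sum family, security provides keys that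
make the messages of these inputs arise from zero inputs and that vanish outside of the groups
contained in these `n + 1` users. Distinct inputs require distinct keys, so `n * L` symbols are
encoded in `(n + 1).choose G * LS` key symbols. If `G = 1`, no key is shared and the message of a
user alone already determines its input.

Achievability. Each user adds to its input a linear combination of its keys, the coefficients of
every key summing to zero. Such a scheme is secure if the keys of the groups in any `K - T` users
suffice to mask every zero-sum family of inputs of these users, that is, if a matrix of coefficients
is right invertible. For one set of `K - T` users explicit coefficients exist. Over a sufficiently
large extension field generic coefficients then serve all such sets at once, and a scheme over the
extension is a scheme over `F` with longer blocks.
-/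

namespace SecureSummation

section Entropy

/-- The number of sample points at which `X` takes the value `a`: `card Ω` times the probability
of `X = a`. -/
noncomputable def fiberCard {Ω α : Type*} (X : Ω → α) (a : α) : ℕ := (X ⁻¹' {a}).ncard

variable {Ω α β γ : Type*}

lemma fiberCard_eq_card_filter [Fintype Ω] [DecidableEq α] (X : Ω → α) (a : α) :
    fiberCard X a = (Finset.univ.filter fun ω => X ω = a).card := by
  rw [fiberCard, ← Set.ncard_coe_finset]
  congr 1
  ext ω
  simp

section Finite

variable [Finite Ω]

lemma fiberCard_pos_iff {X : Ω → α} {a : α} : 0 < fiberCard X a ↔ ∃ ω, X ω = a :=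
  Set.ncard_pos

lemma fiberCard_apply_pos (X : Ω → α) (ω : Ω) : 0 < fiberCard X (X ω) :=
  fiberCard_pos_iff.2 ⟨ω, rfl⟩

lemma fiberCard_prodMk_le (X : Ω → α) (Y : Ω → β) (a : α) (b : β) :
    fiberCard (fun ω => (X ω, Y ω)) (a, b) ≤ fiberCard Y b :=
  Set.ncard_le_ncard fun _ hω => congrArg Prod.snd hω

lemma fiberCard_le_of_perm {X : Ω → α} {a b : α} (σ : Equiv.Perm Ω)
    (h : ∀ ω, X ω = a → X (σ ω) = b) : fiberCard X a ≤ fiberCard X b :=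
  Set.ncard_le_ncard_of_injOn σ h σ.injective.injOn

lemma sum_fiberCard_prodMk [Fintype α] (X : Ω → α) (Y : Ω → β) (b : β) :
    ∑ a, fiberCard (fun ω => (X ω, Y ω)) (a, b) = fiberCard Y b := by
  classical
  cases nonempty_fintype Ω
  simp only [fiberCard_eq_card_filter, Finset.card_filter, Prod.mk.injEq, ite_and]
  rw [Finset.sum_comm]
  simp

end Finite

variable [Fintype Ω]

lemma sum_fiberCard_mul [Fintype α] (X : Ω → α) (f : α → ℝ) :
    ∑ a, (fiberCard X a : ℝ) * f a = ∑ ω, f (X ω) := by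
  classical
  simp only [← Finset.sum_fiberwise' Finset.univ X f, Finset.sum_const, nsmul_eq_mul,
    fiberCard_eq_card_filter]

lemma sum_fiberCard [Fintype α] (X : Ω → α) : ∑ a, (fiberCard X a : ℝ) = Fintype.card Ω := by
  simpa using sum_fiberCard_mul X 1

lemma sum_fiberCard_mul_div_fiberCard [Fintype α] [Fintype β] [Fintype γ]
    (X : Ω → α) (Y : Ω → β) (V : Ω → γ) :
    ∑ a : α × β × γ, (fiberCard (fun ω => (X ω, V ω)) (a.1, a.2.2) : ℝ) *
      fiberCard (fun ω => (Y ω, V ω)) a.2 / fiberCard V a.2.2 = Fintype.card Ω := by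
  rw [Fintype.sum_prod_type_right, ← sum_fiberCard fun ω => (Y ω, V ω)]
  refine Finset.sum_congr rfl fun ⟨y, v⟩ _ => ?_
  dsimp only
  rw [← Finset.sum_div, ← Finset.sum_mul, ← Nat.cast_sum, sum_fiberCard_prodMk]
  refine mul_div_cancel_left_of_imp fun hv => ?_
  have hle := fiberCard_prodMk_le Y V y v
  rw [Nat.cast_eq_zero] at hv ⊢
  exact Nat.le_zero.1 (hv ▸ hle)

variable [Nonempty Ω]

lemma toReal_map_uniformOfFintype (X : Ω → α) (a : α) :
    ((PMF.uniformOfFintype Ω).map X a).toReal = (fiberCard X a : ℝ) / Fintype.card Ω := by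
  classical
  rw [PMF.map_apply, tsum_fintype]
  simp only [PMF.uniformOfFintype_apply]
  rw [← Finset.sum_filter, Finset.sum_const, nsmul_eq_mul, ENNReal.toReal_mul]
  simp [fiberCard_eq_card_filter, div_eq_mul_inv, eq_comm]

lemma entropy_eq [Fintype α] (q : ℕ) (X : Ω → α) :
    entropy q X = (∑ ω, (Real.log (Fintype.card Ω) - Real.log (fiberCard X (X ω)))) /
      (Fintype.card Ω * Real.log q) := by
  have hterm (a : α) : Real.negMulLog ((PMF.uniformOfFintype Ω).map X a).toReal =
      fiberCard X a * ((Real.log (Fintype.card Ω) - Real.log (fiberCard X a)) /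
        Fintype.card Ω) := by
    rw [toReal_map_uniformOfFintype, Real.negMulLog]
    rcases eq_or_ne (fiberCard X a : ℝ) 0 with h | h
    · simp [h]
    · rw [Real.log_div h (by positivity)]
      ring
  simp only [entropy, pmfEntropy, hterm]
  rw [sum_fiberCard_mul X
    fun a => (Real.log (Fintype.card Ω) - Real.log (fiberCard X a)) / Fintype.card Ω,
    ← Finset.sum_div, div_div]

lemma condEntropy_eq [Fintype α] [Fintype β] (q : ℕ) (X : Ω → α) (Y : Ω → β) :
    condEntropy q X Y = (∑ ω, (Real.log (fiberCard Y (Y ω)) -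
      Real.log (fiberCard (fun ω => (X ω, Y ω)) (X ω, Y ω)))) /
      (Fintype.card Ω * Real.log q) := by
  rw [condEntropy, entropy_eq, entropy_eq, ← sub_div, ← Finset.sum_sub_distrib]
  simp only [sub_sub_sub_cancel_left]

lemma condMutualInfo_eq [Fintype α] [Fintype β] [Fintype γ] (q : ℕ)
    (X : Ω → α) (Y : Ω → β) (V : Ω → γ) :
    condMutualInfo q X Y V = (∑ ω,
      Real.log (fiberCard (fun ω => (X ω, Y ω, V ω)) (X ω, Y ω, V ω) /
        (fiberCard (fun ω => (X ω, V ω)) (X ω, V ω) *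
          fiberCard (fun ω => (Y ω, V ω)) (Y ω, V ω) / fiberCard V (V ω)))) /
      (Fintype.card Ω * Real.log q) := by
  rw [condMutualInfo, condEntropy_eq, condEntropy_eq, ← sub_div, ← Finset.sum_sub_distrib]
  congr 1
  refine Finset.sum_congr rfl fun ω _ => ?_
  have hV := fiberCard_apply_pos V ω
  have hXV := fiberCard_apply_pos (fun ω => (X ω, V ω)) ω
  have hYV := fiberCard_apply_pos (fun ω => (Y ω, V ω)) ω
  have hXYV := fiberCard_apply_pos (fun ω => (X ω, Y ω, V ω)) ω
  rw [Real.log_div (by positivity) (by positivity), Real.log_div (by positivity) (by positivity),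
    Real.log_mul (by positivity) (by positivity)]
  ring

lemma card_mul_log_ne_zero {q : ℕ} (hq : 1 < q) : (Fintype.card Ω : ℝ) * Real.log q ≠ 0 :=
  mul_ne_zero (by positivity) (Real.log_pos (by exact_mod_cast hq)).ne'

lemma condEntropy_eq_zero_iff [Fintype α] [Fintype β] {q : ℕ} (hq : 1 < q)
    (X : Ω → α) (Y : Ω → β) : condEntropy q X Y = 0 ↔ X.FactorsThrough Y := by
  have hpos (ω : Ω) : (0 : ℝ) < fiberCard (fun ω => (X ω, Y ω)) (X ω, Y ω) := by
    exact_mod_cast fiberCard_apply_pos _ ω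
  have hposY (ω : Ω) : (0 : ℝ) < fiberCard Y (Y ω) := by exact_mod_cast fiberCard_apply_pos Y ω
  have hsub (ω : Ω) : (fun ω => (X ω, Y ω)) ⁻¹' {(X ω, Y ω)} ⊆ Y ⁻¹' {Y ω} :=
    fun _ h => congrArg Prod.snd h
  have hterm (ω : Ω) : Real.log (fiberCard Y (Y ω)) -
      Real.log (fiberCard (fun ω => (X ω, Y ω)) (X ω, Y ω)) = 0 ↔
        ∀ ω', Y ω' = Y ω → X ω' = X ω := by
    rw [sub_eq_zero, Real.log_injOn_pos.eq_iff (hposY ω) (hpos ω), Nat.cast_inj]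
    refine ⟨fun h ω' hω' => ?_, fun h => congrArg Set.ncard ?_⟩
    · have hmem : ω' ∈ (fun ω => (X ω, Y ω)) ⁻¹' {(X ω, Y ω)} :=
        (Set.eq_of_subset_of_ncard_le (hsub ω) h.le).ge hω'
      exact congrArg Prod.fst hmem
    · exact Set.Subset.antisymm (fun ω' hω' => Prod.ext (h ω' hω') hω') (hsub ω)
  rw [condEntropy_eq, div_eq_zero_iff, or_iff_left (card_mul_log_ne_zero hq),
    Finset.sum_eq_zero_iff_of_nonneg fun ω _ => sub_nonneg.2
      (Real.log_le_log (hpos ω) (by exact_mod_cast fiberCard_prodMk_le X Y _ _))]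
  simp only [Finset.mem_univ, true_imp_iff, hterm]
  exact forall_comm

lemma sum_mul_log_div_eq_zero_iff {ι : Type*} [Fintype ι] {p r : ι → ℝ} (hp : ∀ i, 0 ≤ p i)
    (hr : ∀ i, 0 ≤ r i) (hpr : ∀ i, r i = 0 → p i = 0) (hsum : ∑ i, p i = ∑ i, r i) :
    ∑ i, p i * Real.log (p i / r i) = 0 ↔ p = r := by
  have hkl (i : ι) :
      r i * InformationTheory.klFun (p i / r i) = p i * Real.log (p i / r i) + r i - p i := by
    rcases eq_or_ne (r i) 0 with h | h
    · simp [h, hpr i h]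
    · rw [InformationTheory.klFun_apply]
      field_simp
  have hnonneg (i : ι) : 0 ≤ p i / r i := div_nonneg (hp i) (hr i)
  have hsum_kl : ∑ i, p i * Real.log (p i / r i) =
      ∑ i, r i * InformationTheory.klFun (p i / r i) := by
    simp only [hkl, Finset.sum_sub_distrib, Finset.sum_add_distrib, hsum, add_sub_cancel_right]
  rw [hsum_kl, Finset.sum_eq_zero_iff_of_nonneg fun i _ =>
    mul_nonneg (hr i) (InformationTheory.klFun_nonneg (hnonneg i)), funext_iff]
  simp only [Finset.mem_univ, true_imp_iff, mul_eq_zero,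
    InformationTheory.klFun_eq_zero_iff (hnonneg _)]
  refine forall_congr' fun i => ?_
  rcases eq_or_ne (r i) 0 with h | h
  · simp [h, hpr i h]
  · simp [h, div_eq_one_iff_eq]

lemma condMutualInfo_eq_zero_iff [Fintype α] [Fintype β] [Fintype γ] {q : ℕ} (hq : 1 < q)
    (X : Ω → α) (Y : Ω → β) (V : Ω → γ) :
    condMutualInfo q X Y V = 0 ↔ ∀ x y v,
      fiberCard (fun ω => (X ω, Y ω, V ω)) (x, y, v) * fiberCard V v =
        fiberCard (fun ω => (X ω, V ω)) (x, v) * fiberCard (fun ω => (Y ω, V ω)) (y, v) := by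
  let XYV : Ω → α × β × γ := fun ω => (X ω, Y ω, V ω)
  let XV : Ω → α × γ := fun ω => (X ω, V ω)
  let YV : Ω → β × γ := fun ω => (Y ω, V ω)
  let p : α × β × γ → ℝ := fun a => fiberCard XYV a
  let r : α × β × γ → ℝ := fun a => fiberCard XV (a.1, a.2.2) * fiberCard YV a.2 / fiberCard V a.2.2
  have hXV (a : α × β × γ) : fiberCard XYV a ≤ fiberCard XV (a.1, a.2.2) :=
    Set.ncard_le_ncard fun ω (hω : XYV ω = a) => hω ▸ rfl
  have hYV (a : α × β × γ) : fiberCard XYV a ≤ fiberCard YV a.2 :=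
    fiberCard_prodMk_le X YV a.1 a.2
  have hV (a : α × β × γ) : fiberCard XYV a ≤ fiberCard V a.2.2 :=
    (hYV a).trans (fiberCard_prodMk_le Y V _ _)
  have hpr (a) (ha : r a = 0) : p a = 0 := by
    simp only [r, div_eq_zero_iff, mul_eq_zero, Nat.cast_eq_zero] at ha
    have := hXV a
    have := hYV a
    have := hV a
    exact Nat.cast_eq_zero.2 (by omega)
  have hiff (a) : p a = r a ↔ fiberCard XYV a * fiberCard V a.2.2 =
      fiberCard XV (a.1, a.2.2) * fiberCard YV a.2 := by
    rcases Nat.eq_zero_or_pos (fiberCard V a.2.2) with h | h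
    · have hp := Nat.le_zero.1 (h ▸ hV a)
      have hy := Nat.le_zero.1 (h ▸ fiberCard_prodMk_le Y V a.2.1 a.2.2)
      simp [p, r, h, hp, YV, hy]
    · simp only [p, r]
      rw [eq_div_iff (by positivity)]
      exact_mod_cast Iff.rfl
  have hgibbs := sum_mul_log_div_eq_zero_iff (p := p) (r := r) (fun _ => by positivity)
    (fun _ => by positivity) hpr
    ((sum_fiberCard XYV).trans (sum_fiberCard_mul_div_fiberCard X Y V).symm)
  rw [sum_fiberCard_mul XYV fun a => Real.log (p a / r a), funext_iff] at hgibbs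
  rw [condMutualInfo_eq, div_eq_zero_iff, or_iff_left (card_mul_log_ne_zero hq)]
  simpa only [hiff, Prod.forall] using hgibbs

lemma exists_of_condMutualInfo_eq_zero [Fintype α] [Fintype β] [Fintype γ] {q : ℕ} (hq : 1 < q)
    {X : Ω → α} {Y : Ω → β} {V : Ω → γ} (h : condMutualInfo q X Y V = 0) {ω₁ ω₂ : Ω}
    (hV : V ω₁ = V ω₂) : ∃ ω, X ω = X ω₁ ∧ Y ω = Y ω₂ ∧ V ω = V ω₁ := by
  have hXV := fiberCard_apply_pos (fun ω => (X ω, V ω)) ω₁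
  have hYV := fiberCard_apply_pos (fun ω => (Y ω, V ω)) ω₂
  rw [← hV] at hYV
  have hXYV := (condMutualInfo_eq_zero_iff hq X Y V).1 h (X ω₁) (Y ω₂) (V ω₁) ▸ mul_pos hXV hYV
  obtain ⟨ω, hω⟩ := fiberCard_pos_iff.1 (Nat.pos_of_mul_pos_right hXYV)
  exact ⟨ω, by simpa only [Prod.mk.injEq] using hω⟩

lemma condMutualInfo_eq_zero_of_perm [Fintype α] [Fintype β] [Fintype γ] {q : ℕ} (hq : 1 < q)
    {X : Ω → α} {Y : Ω → β} {V : Ω → γ}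
    (h : ∀ ω₁ ω₂, V ω₁ = V ω₂ → ∃ σ : Equiv.Perm Ω, (∀ ω, X ω = X ω₁ → X (σ ω) = X ω₂) ∧
      (∀ ω, Y (σ ω) = Y ω) ∧ ∀ ω, V (σ ω) = V ω) : condMutualInfo q X Y V = 0 := by
  refine (condMutualInfo_eq_zero_iff hq X Y V).2 fun x y v => ?_
  have hle {x₁ x₂} (h₁ : 0 < fiberCard (fun ω => (X ω, V ω)) (x₁, v))
      (h₂ : 0 < fiberCard (fun ω => (X ω, V ω)) (x₂, v)) :
      fiberCard (fun ω => (X ω, V ω)) (x₁, v) ≤ fiberCard (fun ω => (X ω, V ω)) (x₂, v) ∧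
      fiberCard (fun ω => (X ω, Y ω, V ω)) (x₁, y, v) ≤
        fiberCard (fun ω => (X ω, Y ω, V ω)) (x₂, y, v) := by
    obtain ⟨ω₁, h₁⟩ := fiberCard_pos_iff.1 h₁
    obtain ⟨ω₂, h₂⟩ := fiberCard_pos_iff.1 h₂
    simp only [Prod.mk.injEq] at h₁ h₂
    obtain ⟨σ, hX, hY, hV⟩ := h ω₁ ω₂ (h₁.2.trans h₂.2.symm)
    constructor <;> refine fiberCard_le_of_perm σ fun ω hω => ?_ <;> simp_all
  have hXYV (x) : fiberCard (fun ω => (X ω, Y ω, V ω)) (x, y, v) ≤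
      fiberCard (fun ω => (X ω, V ω)) (x, v) := Set.ncard_le_ncard fun ω => by simp_all
  have hswap (x') : fiberCard (fun ω => (X ω, Y ω, V ω)) (x, y, v) *
      fiberCard (fun ω => (X ω, V ω)) (x', v) = fiberCard (fun ω => (X ω, V ω)) (x, v) *
      fiberCard (fun ω => (X ω, Y ω, V ω)) (x', y, v) := by
    rcases Nat.eq_zero_or_pos (fiberCard (fun ω => (X ω, V ω)) (x, v)) with hx | hx
    · simp [hx, Nat.le_zero.1 (hx ▸ hXYV x)]
    rcases Nat.eq_zero_or_pos (fiberCard (fun ω => (X ω, V ω)) (x', v)) with hx' | hx'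
    · simp [hx', Nat.le_zero.1 (hx' ▸ hXYV x')]
    rw [(hle hx hx').1.antisymm (hle hx' hx).1, (hle hx hx').2.antisymm (hle hx' hx).2, mul_comm]
  calc _ = ∑ x', fiberCard (fun ω => (X ω, Y ω, V ω)) (x, y, v) *
        fiberCard (fun ω => (X ω, V ω)) (x', v) := by rw [← Finset.mul_sum, sum_fiberCard_prodMk]
    _ = ∑ x', fiberCard (fun ω => (X ω, V ω)) (x, v) *
        fiberCard (fun ω => (X ω, Y ω, V ω)) (x', y, v) := Finset.sum_congr rfl fun x' _ => hswap x'
    _ = _ := by rw [← Finset.mul_sum, sum_fiberCard_prodMk X fun ω => (Y ω, V ω)]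

end Entropy

section GroupMap

variable {K N G : ℕ}

/-- The injection of groups induced by an embedding `e` of a smaller set of users. -/
def Group.map (e : Fin N ↪ Fin K) : Group N G ↪ Group K G where
  toFun A := ⟨A.1.map e, (Finset.card_map e).trans A.2⟩
  inj' _ _ h := Subtype.ext (Finset.map_injective e (congrArg Subtype.val h))

lemma coe_groupMap (e : Fin N ↪ Fin K) (A : Group N G) : (Group.map e A).1 = A.1.map e := rfl

lemma mem_range_groupMap {e : Fin N ↪ Fin K} {A : Group K G} :
    A ∈ Set.range (Group.map e) ↔ ∀ k ∈ A.1, k ∈ Set.range e := by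
  constructor
  · rintro ⟨B, rfl⟩ k hk
    obtain ⟨i, -, rfl⟩ := Finset.mem_map.1 hk
    exact ⟨i, rfl⟩
  · intro h
    obtain ⟨B, -, hB⟩ := Finset.subset_map_iff (f := e) (s := A.1) (t := Finset.univ) |>.1
      fun k hk => by simpa using h k hk
    exact ⟨⟨B, by rw [← A.2, hB, Finset.card_map]⟩, Subtype.ext hB.symm⟩

lemma card_group : Fintype.card (Group N G) = N.choose G := by
  rw [Fintype.card_finset_len, Fintype.card_fin]

end GroupMap

section Converse

variable {F : Type*} {K G L LX LS : ℕ}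

lemma message_congr (c : Scheme F K G L LX LS) {k : Fin K} {ω ω' : Sample F K G L LS}
    (hinput : ω.1 k = ω'.1 k) (hkey : ∀ A : Group K G, k ∈ A.1 → ω.2 A = ω'.2 A) :
    message c k ω = message c k ω' :=
  congrArg₂ (c k) hinput (funext fun A => hkey A.1 A.2)

variable [Field F] [Fintype F] {c : Scheme F K G L LX LS}

lemma IsCorrect.inputSum_eq (hc : IsCorrect c) {ω ω' : Sample F K G L LS}
    (h : ∀ k, message c k ω = message c k ω') : inputSum ω = inputSum ω' :=
  (condEntropy_eq_zero_iff Fintype.one_lt_card _ _).1 hc (funext h)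

-- The other users cannot tell `ω` from `ω'`, so only the input of `k` can change the sum.
lemma IsCorrect.input_eq (hc : IsCorrect c) {k : Fin K} {ω ω' : Sample F K G L LS}
    (hmsg : message c k ω = message c k ω')
    (hkey : ∀ A : Group K G, k ∈ A.1 → ∀ j ∈ A.1, j ≠ k → ω.2 A = ω'.2 A) :
    input k ω = input k ω' := by
  let ω₁ : Sample F K G L LS :=
    (Function.update ω.1 k (ω'.1 k), fun A => if k ∈ A.1 then ω'.2 A else ω.2 A)
  have hne {j : Fin K} (hj : j ≠ k) : ω.1 j = ω₁.1 j := by simp [ω₁, hj]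
  have hmsg₁ (j : Fin K) : message c j ω = message c j ω₁ := by
    by_cases hj : j = k
    · subst hj
      refine hmsg.trans (message_congr c (by simp [ω₁]) fun A hA => (if_pos hA).symm)
    · refine message_congr c (hne hj) fun A hA => ?_
      by_cases hk : k ∈ A.1
      · exact (hkey A hk j hA hj).trans (if_pos hk).symm
      · exact (if_neg hk).symm
  have hk : ω.1 k = ω₁.1 k := (Finset.sum_eq_sum_iff_single (Finset.mem_univ k)
    fun j _ => hne).1 (hc.inputSum_eq hmsg₁)
  exact hk.trans (Function.update_self ..)

lemma IsCorrect.length_le (hc : IsCorrect c) (k : Fin K) : L ≤ LX := by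
  have hinj : Function.Injective fun w : Fin L → F =>
      message c k ((fun _ => w, 0) : Sample F K G L LS) := fun w w' h =>
    hc.input_eq (ω := (fun _ => w, 0)) (ω' := (fun _ => w', 0)) h fun _ _ _ _ _ => rfl
  have hcard := Fintype.card_le_of_injective _ hinj
  simp only [Fintype.card_fun, Fintype.card_fin] at hcard
  exact (Nat.pow_le_pow_iff_right Fintype.one_lt_card).1 hcard

lemma IsSecure.exists_masking_keys {T : ℕ} (hs : IsSecure T c) {C : Finset (Fin K)}
    (hC : C.card ≤ T) {W : Fin K → Fin L → F} (hWC : ∀ k ∈ C, W k = 0) (hW : ∑ k, W k = 0) :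
    ∃ S : Group K G → Fin LS → F, (∀ k, message c k (0, S) = message c k (W, 0)) ∧
      ∀ A, ∀ k ∈ A.1, k ∈ C → S A = 0 := by
  obtain ⟨⟨W', S⟩, hX, hY, hV⟩ := exists_of_condMutualInfo_eq_zero Fintype.one_lt_card (hs C hC)
    (ω₁ := 0) (ω₂ := (W, 0)) (Prod.ext (by simp [inputSum, input, hW])
      (funext fun k => Prod.ext (hWC k k.2).symm rfl))
  obtain rfl : W' = 0 := hX
  refine ⟨S, congrFun hY, fun A k hkA hkC => ?_⟩
  exact congrFun (congrArg Prod.snd (congrFun (congrArg Prod.snd hV) ⟨k, hkC⟩)) ⟨A, hkA⟩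

lemma key_length_le {T n : ℕ} (e : Fin (n + 1) ↪ Fin K) (hn : K ≤ T + (n + 1))
    (hc : IsCorrect c) (hs : IsSecure T c) : n * L ≤ (n + 1).choose G * LS := by
  let C : Finset (Fin K) := (Finset.univ.map e)ᶜ
  have hC : C.card ≤ T := by
    rw [Finset.card_compl, Finset.card_map, Finset.card_univ, Fintype.card_fin, Fintype.card_fin]
    omega
  let W (d : Fin n → Fin L → F) : Fin K → Fin L → F :=
    Function.extend e (Fin.cons (-∑ i, d i) d) 0
  have hW_succ (d i) : W d (e i.succ) = d i := e.injective.extend_apply _ _ _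
  have hW_out (d k) (hk : k ∉ Set.range e) : W d k = 0 := Function.extend_apply' _ _ _ hk
  have hW_sum (d) : ∑ k, W d k = 0 := by
    rw [← Fintype.sum_of_injective e e.injective (Fin.cons (-∑ i, d i) d) (W d) (hW_out d)
      fun i => (e.injective.extend_apply _ _ _).symm, Fin.sum_cons, neg_add_cancel]
  choose S hmsg hS using fun d =>
    hs.exists_masking_keys hC (fun k hk => hW_out d k (by simpa [C] using hk)) (hW_sum d)
  have hinj : Function.Injective fun d A => S d (Group.map e A) := fun d d' h => by
    have hSS : S d = S d' := funext fun A => by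
      by_cases hA : A ∈ Set.range (Group.map e)
      · obtain ⟨B, rfl⟩ := hA
        exact congrFun h B
      · obtain ⟨k, hkA, hk⟩ := by simpa only [mem_range_groupMap, not_forall] using hA
        rw [hS d A k hkA (by simpa [C] using hk), hS d' A k hkA (by simpa [C] using hk)]
    funext i
    rw [← hW_succ d, ← hW_succ d']
    refine hc.input_eq (ω := (W d, 0)) (ω' := (W d', 0)) ?_ fun _ _ _ _ _ => rfl
    rw [← hmsg, ← hmsg, hSS]
  have hcard := Fintype.card_le_of_injective _ hinj
  simp only [Fintype.card_fun, Fintype.card_fin, card_group, ← pow_mul] at hcard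
  linarith [(Nat.pow_le_pow_iff_right Fintype.one_lt_card).1 hcard]

lemma not_isSecure_of_one {T LX LS : ℕ} {c : Scheme F K 1 L LX LS} (hK : 2 ≤ K) (hL : 0 < L)
    (hc : IsCorrect c) : ¬ IsSecure T c := fun hs => by
  let i : Fin K := ⟨0, by omega⟩
  let j : Fin K := ⟨1, by omega⟩
  have hij : i ≠ j := by simp [i, j]
  obtain ⟨S, hS, -⟩ := hs.exists_masking_keys (C := ∅) (W := Pi.single i 1 - Pi.single j 1)
    (Nat.zero_le T) (by simp) (by simp [Finset.sum_sub_distrib])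
  have hi := hc.input_eq (hS i) fun A hiA k hkA hki =>
    absurd (Finset.card_le_one.1 A.2.le k hkA i hiA) hki
  simpa [input, hij] using congrFun hi ⟨0, hL⟩

end Converse

section Masking

variable {U V : Type*} [AddCommGroup U] [AddCommGroup V]

/-- The coefficients `h` mask zero-sum families: every family `y` of values with sum zero, one for
each user in `ι`, is of the form `∑ A, h i A (S A)` for some keys `S`. -/
def Masks {ι κ U V : Type*} [Fintype ι] [Fintype κ] [AddCommMonoid V] (h : ι → κ → U → V) : Prop :=
  ∀ y : ι → V, ∑ i, y i = 0 → ∃ S : κ → U, ∀ i, ∑ A, h i A (S A) = y i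

variable {K N G T : ℕ} {h : Fin K → Group K G → U →+ V}

lemma Masks.exists_keys {e : Fin N ↪ Fin K} (hmasks : Masks fun i A => h (e i) (Group.map e A))
    (hsupp : ∀ k A, k ∉ A.1 → h k A = 0) {W : Fin K → V} (hWe : ∀ k ∉ Set.range e, W k = 0)
    (hW : ∑ k, W k = 0) :
    ∃ S : Group K G → U, (∀ A, ∀ k ∈ A.1, k ∉ Set.range e → S A = 0) ∧
      ∀ k, ∑ A, h k A (S A) = W k := by
  obtain ⟨S, hS⟩ := hmasks (W ∘ e) <|
    (Fintype.sum_of_injective e e.injective (W ∘ e) W hWe fun _ => rfl).trans hW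
  have hS_map (B) : Function.extend (Group.map e) S 0 (Group.map e B) = S B :=
    (Group.map e).injective.extend_apply _ _ _
  have hS_out (A) (hA : A ∉ Set.range (Group.map e)) : Function.extend (Group.map e) S 0 A = 0 :=
    Function.extend_apply' _ _ _ hA
  refine ⟨Function.extend (Group.map e) S 0,
    fun A k hkA hk => hS_out A fun hA => hk (mem_range_groupMap.1 hA k hkA), fun k => ?_⟩
  rw [← Fintype.sum_of_injective (Group.map e) (Group.map e).injective
    (fun B => h k (Group.map e B) (S B)) _ (fun A hA => by rw [hS_out A hA, map_zero])
    fun B => by rw [hS_map]]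
  by_cases hk : k ∈ Set.range e
  · obtain ⟨i, rfl⟩ := hk
    exact hS i
  · rw [hWe k hk]
    refine Finset.sum_eq_zero fun B _ => ?_
    rw [hsupp k _ fun hkB => hk (mem_range_groupMap.1 ⟨B, rfl⟩ k hkB), AddMonoidHom.zero_apply]

lemma exists_embedding_of_card_le (hN : 2 ≤ N) (hK : T + N ≤ K) {C : Finset (Fin K)}
    (hC : C.card ≤ T) {i j : Fin K} (hi : i ∉ C) (hj : j ∉ C) :
    ∃ e : Fin N ↪ Fin K, i ∈ Set.range e ∧ j ∈ Set.range e ∧ ∀ k ∈ C, k ∉ Set.range e := by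
  obtain ⟨B, hijB, hBC, hB⟩ := Finset.exists_subsuperset_card_eq (s := {i, j}) (t := Cᶜ) (n := N)
    (by simp [Finset.insert_subset_iff, hi, hj]) (Finset.card_le_two.trans hN)
    (by rw [Finset.card_compl, Fintype.card_fin]; omega)
  rw [Finset.insert_subset_iff, Finset.singleton_subset_iff] at hijB
  refine ⟨(B.orderEmbOfFin hB).toEmbedding, ?_⟩
  simp only [RelEmbedding.coe_toEmbedding, Finset.range_orderEmbOfFin, Finset.mem_coe]
  exact ⟨hijB.1, hijB.2, fun k hk hkB => Finset.mem_compl.1 (hBC hkB) hk⟩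

-- A zero-sum family is a sum of families supported on pairs `{j, r}` of honest users.
lemma exists_keys_of_card_le (hN : 2 ≤ N) (hK : T + N ≤ K)
    (hmasks : ∀ e : Fin N ↪ Fin K, Masks fun i A => h (e i) (Group.map e A))
    (hsupp : ∀ k A, k ∉ A.1 → h k A = 0) {C : Finset (Fin K)} (hC : C.card ≤ T) {W : Fin K → V}
    (hWC : ∀ k ∈ C, W k = 0) (hW : ∑ k, W k = 0) :
    ∃ S : Group K G → U, (∀ A, ∀ k ∈ A.1, k ∈ C → S A = 0) ∧ ∀ k, ∑ A, h k A (S A) = W k := by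
  obtain ⟨r, hr⟩ : ∃ r, r ∉ C := by
    by_contra! hall
    rw [Finset.eq_univ_of_forall hall, Finset.card_univ, Fintype.card_fin] at hC
    omega
  let pair (j : Fin K) : Fin K → V := Pi.single j (W j) - Pi.single r (W j)
  have hpair (j) : ∃ S : Group K G → U, (∀ A, ∀ k ∈ A.1, k ∈ C → S A = 0) ∧
      ∀ k, ∑ A, h k A (S A) = pair j k := by
    by_cases hj : j ∈ C
    · exact ⟨0, fun _ _ _ _ => rfl, fun k => by simp [pair, hWC j hj]⟩
    obtain ⟨e, hje, hre, hCe⟩ := exists_embedding_of_card_le hN hK hC hj hr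
    have hne {i k} (hi : i ∈ Set.range e) (hk : k ∉ Set.range e) : k ≠ i := fun h => hk (h ▸ hi)
    obtain ⟨S, hS_out, hS⟩ := (hmasks e).exists_keys hsupp (W := pair j)
      (fun k hk => by simp [pair, hne hje hk, hne hre hk])
      (by simp [pair, Finset.sum_sub_distrib])
    exact ⟨S, fun A k hkA hkC => hS_out A k hkA (hCe k hkC), hS⟩
  choose S hSC hS using hpair
  have hsum : ∑ j, pair j = W := by
    have hr_sum : ∑ j, (Pi.single r (W j) : Fin K → V) = 0 := by
      have := map_sum (AddMonoidHom.single (fun _ : Fin K => V) r) W Finset.univ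
      simpa [hW] using this.symm
    simp only [pair, Finset.sum_sub_distrib, Finset.univ_sum_single, hr_sum, sub_zero]
  refine ⟨∑ j, S j, fun A k hkA hkC => ?_, fun k => ?_⟩
  · rw [Finset.sum_apply]
    exact Finset.sum_eq_zero fun j _ => hSC j A k hkA hkC
  · simp only [Finset.sum_apply, map_sum]
    rw [Finset.sum_comm, Finset.sum_congr rfl fun j _ => hS j k, ← Finset.sum_apply, hsum]

end Masking

section MaskingScheme

variable {F : Type*} [Field F] {K G L LS T : ℕ}
  {h : Fin K → Group K G → (Fin LS → F) →+ (Fin L → F)}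

/-- The scheme in which every user adds to its input a combination of the keys it knows, with
coefficients `h`. -/
def maskingScheme (h : Fin K → Group K G → (Fin LS → F) →+ (Fin L → F)) : Scheme F K G L L LS :=
  fun k w z => w + ∑ A : GroupOf K G k, h k A.1 (z A)

lemma message_maskingScheme (hsupp : ∀ k A, k ∉ A.1 → h k A = 0) (k : Fin K)
    (ω : Sample F K G L LS) :
    message (maskingScheme h) k ω = ω.1 k + ∑ A, h k A (ω.2 A) :=
  congrArg (ω.1 k + ·) <| Fintype.sum_of_injective Subtype.val Subtype.val_injective _ _
    (fun A hA => by simp [hsupp k A (by simpa using hA)]) fun _ => rfl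

variable [Fintype F]

lemma isCorrect_maskingScheme (hsupp : ∀ k A, k ∉ A.1 → h k A = 0) (hsum : ∀ A, ∑ k, h k A = 0) :
    IsCorrect (maskingScheme h) := by
  have hmsg (ω : Sample F K G L LS) : ∑ k, message (maskingScheme h) k ω = inputSum ω := by
    simp only [message_maskingScheme hsupp, Finset.sum_add_distrib]
    rw [Finset.sum_comm]
    simp only [← AddMonoidHom.finsetSum_apply, hsum, AddMonoidHom.zero_apply, Finset.sum_const_zero,
      add_zero]
    rfl
  refine (condEntropy_eq_zero_iff Fintype.one_lt_card _ _).2 fun ω ω' hω => ?_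
  rw [← hmsg, ← hmsg]
  exact Finset.sum_congr rfl fun k _ => congrFun hω k

-- Shifting the inputs and compensating by keys that mask the difference is a bijection of the
-- sample space which the server and the colluding users cannot observe.
lemma isSecure_maskingScheme (hsupp : ∀ k A, k ∉ A.1 → h k A = 0)
    (hkeys : ∀ C : Finset (Fin K), C.card ≤ T → ∀ W : Fin K → Fin L → F, (∀ k ∈ C, W k = 0) →
      ∑ k, W k = 0 → ∃ S : Group K G → Fin LS → F, (∀ A, ∀ k ∈ A.1, k ∈ C → S A = 0) ∧
        ∀ k, ∑ A, h k A (S A) = W k) : IsSecure T (maskingScheme h) := by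
  intro C hC
  refine condMutualInfo_eq_zero_of_perm Fintype.one_lt_card fun ω₁ ω₂ hω => ?_
  obtain ⟨hinputSum, hcolluders⟩ := Prod.mk.inj hω
  let D : Fin K → Fin L → F := ω₂.1 - ω₁.1
  have hD (k) (hk : k ∈ C) : D k = 0 :=
    sub_eq_zero.2 (congrArg Prod.fst (congrFun hcolluders ⟨k, hk⟩)).symm
  have hD_sum : ∑ k, D k = 0 := by
    simp only [D, Pi.sub_apply, Finset.sum_sub_distrib]
    exact sub_eq_zero.2 hinputSum.symm
  obtain ⟨S, hSC, hS⟩ := hkeys C hC (-D) (fun k hk => by rw [Pi.neg_apply, hD k hk, neg_zero])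
    (by simp only [Pi.neg_apply, Finset.sum_neg_distrib, hD_sum, neg_zero])
  refine ⟨Equiv.addRight (D, S), fun ω hX => ?_, fun ω => funext fun k => ?_, fun ω => ?_⟩
  · replace hX : ω.1 = ω₁.1 := hX
    change ω.1 + D = ω₂.1
    rw [hX, add_sub_cancel]
  · simp only [message_maskingScheme hsupp, Equiv.coe_addRight, Prod.fst_add, Prod.snd_add,
      Pi.add_apply, map_add, Finset.sum_add_distrib, hS, Pi.neg_apply]
    abel
  · have hsum : inputSum (ω + (D, S)) = inputSum ω := by
      simp only [inputSum, input, Prod.fst_add, Pi.add_apply, Finset.sum_add_distrib, hD_sum,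
        add_zero]
    exact Prod.ext hsum (funext fun k => Prod.ext (add_eq_left.2 (hD k k.2))
      (funext fun A => add_eq_left.2 (hSC A.1 k A.2 k.2)))

end MaskingScheme

section Balanced

variable {M M' : Type*} [AddCommGroup M] [AddCommGroup M'] {N K G : ℕ}

/-- The coefficients with which the users of a group `A` use the key of `A` when every ordered pair
of users `(k, j)` of `A` adds it with coefficient `Y (k, j, A)` at `k` and subtracts it at `j`. -/
def balanced (Y : Fin K × Fin K × Group K G → M) (k : Fin K) (A : Group K G) : M :=
  if k ∈ A.1 then ∑ j ∈ A.1, (Y (k, j, A) - Y (j, k, A)) else 0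

lemma balanced_of_notMem (Y : Fin K × Fin K × Group K G → M) {k : Fin K} {A : Group K G}
    (hk : k ∉ A.1) : balanced Y k A = 0 :=
  if_neg hk

lemma sum_balanced (Y : Fin K × Fin K × Group K G → M) (A : Group K G) :
    ∑ k, balanced Y k A = 0 := by
  simp only [balanced, Finset.sum_sub_distrib, Finset.sum_ite_mem, Finset.univ_inter]
  rw [Finset.sum_comm, sub_self]

lemma map_balanced (f : M →+ M') (Y : Fin K × Fin K × Group K G → M) (k : Fin K) (A : Group K G) :
    f (balanced Y k A) = balanced (f ∘ Y) k A := by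
  simp only [balanced, apply_ite f, map_sum, map_sub, map_zero, Function.comp_apply]

lemma balanced_embedding (e : Fin N ↪ Fin K) (Y : Fin K × Fin K × Group K G → M) (i : Fin N)
    (A : Group N G) : balanced Y (e i) (Group.map e A) =
      balanced (Y ∘ Prod.map e (Prod.map e (Group.map e))) i A := by
  simp [balanced, coe_groupMap]

end Balanced

section MaskingMatrix

variable {R : Type*} [CommRing R] {n : ℕ} {ι κ Λ Θ : Type*} [Fintype ι] [Fintype κ] [Fintype Θ]

lemma sum_sum_mulVec {h : ι → κ → Matrix Λ Θ R} (hsum : ∀ A, ∑ i, h i A = 0) (S : κ → Θ → R) :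
    ∑ i, ∑ A, (h i A).mulVec (S A) = 0 := by
  rw [Finset.sum_comm]
  simp only [← Matrix.sum_mulVec, hsum, Matrix.zero_mulVec, Finset.sum_const_zero]

/-- The matrix of the linear map that sends keys to the combinations obtained from them with the
coefficients `h` by all users but user `0`. -/
def maskingMatrix (h : Fin (n + 1) → κ → Matrix Λ Θ R) : Matrix (Fin n × Λ) (κ × Θ) R :=
  Matrix.of fun i a => h i.1.succ a.1 i.2 a.2

lemma maskingMatrix_mulVec (h : Fin (n + 1) → κ → Matrix Λ Θ R) (b : κ × Θ → R) (i : Fin n)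
    (l : Λ) : (maskingMatrix h).mulVec b (i, l) =
      (∑ A, (h i.succ A).mulVec fun s => b (A, s)) l := by
  rw [Finset.sum_apply]
  exact Fintype.sum_prod_type _

lemma masks_mulVec_iff [Finite Λ] [DecidableEq Λ] {h : Fin (n + 1) → κ → Matrix Λ Θ R}
    (hsum : ∀ A, ∑ i, h i A = 0) :
    Masks (fun i A => (h i A).mulVec) ↔
      ∃ B : Matrix (κ × Θ) (Fin n × Λ) R, maskingMatrix h * B = 1 := by
  rw [← Matrix.mulVec_surjective_iff_exists_right_inverse]
  constructor
  · intro hmasks v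
    obtain ⟨S, hS⟩ := hmasks (Fin.cons (-∑ i, fun l => v (i, l)) fun i l => v (i, l)) <| by
      rw [Fin.sum_cons, neg_add_cancel]
    exact ⟨fun a => S a.1 a.2, funext fun ⟨i, l⟩ =>
      (maskingMatrix_mulVec h _ i l).trans (congrFun (hS i.succ) l)⟩
  · intro hsurj y hy
    obtain ⟨b, hb⟩ := hsurj fun a => y a.1.succ a.2
    have hsucc (i : Fin n) : ∑ A, (h i.succ A).mulVec (fun s => b (A, s)) = y i.succ :=
      funext fun l => (maskingMatrix_mulVec h b i l).symm.trans (congrFun hb (i, l))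
    have hne (i : Fin (n + 1)) (hi : i ≠ 0) :
        ∑ A, (h i A).mulVec (fun s => b (A, s)) = y i := by
      obtain ⟨i, rfl⟩ := Fin.exists_succ_eq.2 hi
      exact hsucc i
    have hzero := (Finset.sum_eq_sum_iff_single (Finset.mem_univ 0) fun i _ => hne i).1
      ((sum_sum_mulVec hsum _).trans hy.symm)
    exact ⟨fun A s => b (A, s), Fin.cases hzero hsucc⟩

end MaskingMatrix

section Star

variable {m g : ℕ}

lemma exists_edge_of_mem {K : ℕ} (A : Group K (g + 2)) {i j : Fin K} (hi : i ∈ A.1) (hj : j ∈ A.1)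
    (hij : i ≠ j) : ∃ s : Fin (g + 2) × Fin (g + 1),
      A.1.orderEmbOfFin A.2 s.1 = i ∧ A.1.orderEmbOfFin A.2 (s.1.succAbove s.2) = j := by
  rw [← Finset.mem_coe, ← Finset.range_orderEmbOfFin A.1 A.2] at hi hj
  obtain ⟨⟨p, rfl⟩, ⟨p', rfl⟩⟩ := hi, hj
  obtain ⟨s, rfl⟩ := Fin.exists_succAbove_eq fun h => hij (congrArg _ h.symm)
  exact ⟨(p, s), rfl, rfl⟩

-- There are `m.choose g` groups through the edge `{c, c.succAbove i}`, numbered by `t`; a group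
-- reserves one slot for each of its `(g + 2) * (g + 1)` ordered pairs.
lemma exists_edge_slots (m g : ℕ) :
    ∃ σ : Fin (m + 2) × Fin (m + 1) × Fin (m.choose g) ↪
        Group (m + 2) (g + 2) × (Fin (g + 2) × Fin (g + 1)),
      ∀ c i t, c ∈ (σ (c, i, t)).1.1 ∧ c.succAbove i ∈ (σ (c, i, t)).1.1 := by
  have hcard (c : Fin (m + 2)) (i : Fin (m + 1)) :
      (Finset.powersetCard g {c, c.succAbove i}ᶜ).card = m.choose g := by
    rw [Finset.card_powersetCard, Finset.card_compl, Finset.card_pair (Fin.ne_succAbove c i),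
      Fintype.card_fin]
    rfl
  let D (c i) (t : Fin (m.choose g)) : Finset (Fin (m + 2)) :=
    (Finset.equivFinOfCardEq (hcard c i)).symm t
  have hD (c i t) : D c i t ⊆ {c, c.succAbove i}ᶜ ∧ (D c i t).card = g :=
    Finset.mem_powersetCard.1 ((Finset.equivFinOfCardEq (hcard c i)).symm t).2
  have hdisj (c i t) : Disjoint (D c i t) {c, c.succAbove i} :=
    Finset.disjoint_left.2 fun _ hk => Finset.mem_compl.1 ((hD c i t).1 hk)
  let A (c i t) : Group (m + 2) (g + 2) := ⟨D c i t ∪ {c, c.succAbove i}, by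
    rw [Finset.card_union_of_disjoint (hdisj c i t), (hD c i t).2,
      Finset.card_pair (Fin.ne_succAbove c i)]⟩
  have hc (c i t) : c ∈ (A c i t).1 := by simp [A]
  have hi (c i t) : c.succAbove i ∈ (A c i t).1 := by simp [A]
  choose slot hslot using fun c i t =>
    exists_edge_of_mem (A c i t) (hc c i t) (hi c i t) (Fin.ne_succAbove c i)
  refine ⟨⟨fun a => (A a.1 a.2.1 a.2.2, slot a.1 a.2.1 a.2.2), ?_⟩,
    fun c i t => ⟨hc c i t, hi c i t⟩⟩
  rintro ⟨c, i, t⟩ ⟨c', i', t'⟩ h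
  obtain ⟨hA, hs⟩ := Prod.mk.inj h
  have hslot' := hslot c' i' t'
  rw [← hA, ← hs] at hslot'
  obtain rfl : c = c' := (hslot c i t).1.symm.trans hslot'.1
  obtain rfl : i = i' := Fin.succAbove_right_injective ((hslot c i t).2.symm.trans hslot'.2)
  have hDD : D c i t = D c i t' := by
    rw [← Finset.union_sdiff_cancel_right (hdisj c i t),
      ← Finset.union_sdiff_cancel_right (hdisj c i t')]
    exact congrArg (· \ {c, c.succAbove i}) (congrArg Subtype.val hA)
  rw [(Finset.equivFinOfCardEq (hcard c i)).symm.injective (Subtype.ext hDD)]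

lemma exists_balanced_eq_ite (R : Type*) [CommRing R] {n G : ℕ} {τ Θ : Type*} [DecidableEq Θ]
    (σ : Fin (n + 1) × Fin n × τ → Group (n + 1) G × Θ)
    (hσ : ∀ c i t, c ∈ (σ (c, i, t)).1.1 ∧ c.succAbove i ∈ (σ (c, i, t)).1.1) :
    ∃ Y : Fin (n + 1) × Fin (n + 1) × Group (n + 1) G → Matrix (Fin (n + 1) × τ) Θ R,
      ∀ c i t A s, balanced Y (c.succAbove i) A (c, t) s =
        if σ (c, i, t) = (A, s) then 1 else 0 := by
  classical
  let Y : Fin (n + 1) × Fin (n + 1) × Group (n + 1) G → Matrix (Fin (n + 1) × τ) Θ R := fun a =>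
    Matrix.of fun l s =>
      if a.2.1 = l.1 ∧ ∃ i, a.1 = l.1.succAbove i ∧ σ (l.1, i, l.2) = (a.2.2, s) then 1 else 0
  refine ⟨Y, fun c i t A s => ?_⟩
  rw [show balanced Y (c.succAbove i) A (c, t) s = balanced (fun a => Y a (c, t) s) _ A from
    map_balanced (Matrix.entryAddMonoidHom R (c, t) s) Y _ A]
  by_cases h : σ (c, i, t) = (A, s)
  · have hmem := hσ c i t
    rw [h] at hmem
    simp [balanced, Y, h, hmem, Fin.succAbove_ne]
  · simp [balanced, Y, h, Fin.succAbove_ne]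

-- Every input symbol `(c, t)` is masked along the star centered at `c`: the user `c.succAbove i`
-- shares with `c` a key symbol reserved for the edge between them.
lemma exists_masks_balanced (R : Type*) [CommRing R] (m g : ℕ) :
    ∃ Y : Fin (m + 2) × Fin (m + 2) × Group (m + 2) (g + 2) →
        Matrix (Fin (m + 2) × Fin (m.choose g)) (Fin (g + 2) × Fin (g + 1)) R,
      Masks fun i A => (balanced Y i A).mulVec := by
  obtain ⟨σ, hσ⟩ := exists_edge_slots m g
  obtain ⟨Y, hY⟩ := exists_balanced_eq_ite R σ hσ
  refine ⟨Y, fun y hy => ?_⟩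
  let b : Group (m + 2) (g + 2) × (Fin (g + 2) × Fin (g + 1)) → R :=
    Function.extend σ (fun a => y (a.1.succAbove a.2.1) (a.1, a.2.2)) 0
  have hsucc (c i t) : (∑ A, (balanced Y (c.succAbove i) A).mulVec fun s => b (A, s)) (c, t) =
      y (c.succAbove i) (c, t) := by
    rw [Finset.sum_apply]
    simp only [Matrix.mulVec, dotProduct, hY, ite_mul, one_mul, zero_mul]
    rw [← Fintype.sum_prod_type' (fun A s => if σ (c, i, t) = (A, s) then b (A, s) else 0),
      Finset.sum_ite_eq]
    simp [b, σ.injective.extend_apply]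
  have hne (c t) (k : Fin (m + 2)) (hk : k ≠ c) :
      (∑ A, (balanced Y k A).mulVec fun s => b (A, s)) (c, t) = y k (c, t) := by
    obtain ⟨i, rfl⟩ := Fin.exists_succAbove_eq hk
    exact hsucc c i t
  have hcenter (c t) : (∑ A, (balanced Y c A).mulVec fun s => b (A, s)) (c, t) = y c (c, t) := by
    refine (Finset.sum_eq_sum_iff_single (Finset.mem_univ c) fun k _ => hne c t k).1 ?_
    rw [← Finset.sum_apply, ← Finset.sum_apply, sum_sum_mulVec (sum_balanced Y), hy]
  refine ⟨fun A s => b (A, s), fun k => funext fun ⟨c, t⟩ => ?_⟩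
  rcases eq_or_ne k c with rfl | hk
  · exact hcenter k t
  · exact hne c t k hk

end Star

section Generic

universe u

open MvPolynomial

variable {F : Type u} [Field F] {P m n : Type*}

lemma exists_finite_extension_aeval_ne_zero [Finite P] {p : MvPolynomial P F} (hp : p ≠ 0) :
    ∃ (E : Type u) (_ : Field E) (_ : Algebra F E), Module.Finite F E ∧
      ∃ z : P → E, aeval z p ≠ 0 := by
  obtain ⟨z, hz⟩ : ∃ z : P → AlgebraicClosure F, aeval z p ≠ 0 := by
    by_contra! hzero
    refine hp (map_injective _ (algebraMap F (AlgebraicClosure F)).injective ?_)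
    exact MvPolynomial.funext fun z => by
      rw [map_zero, map_zero, eval_map, ← aeval_def, hzero z]
  let E := IntermediateField.adjoin F (Set.range z)
  let zE : P → E := fun a => ⟨z a, IntermediateField.subset_adjoin F _ ⟨a, rfl⟩⟩
  have haeval : aeval z p = algebraMap E (AlgebraicClosure F) (aeval zE p) := by
    rw [← aeval_algebraMap_apply]
    rfl
  refine ⟨E, inferInstance, inferInstance,
    IntermediateField.finiteDimensional_adjoin fun x _ => Algebra.IsIntegral.isIntegral x,
    zE, fun hzE => hz ?_⟩
  rw [haeval, hzE, map_zero]

variable [DecidableEq m] [Fintype n]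

lemma aeval_det_mul [Fintype m] {E : Type*} [CommRing E] [Algebra F E] (z : P → E)
    (M : Matrix m n (MvPolynomial P F)) (B : Matrix n m F) :
    aeval z (M * (B.map C : Matrix n m (MvPolynomial P F)) : Matrix m m (MvPolynomial P F)).det =
      (M.map (aeval z) * (B.map (algebraMap F E) : Matrix n m E) : Matrix m m E).det := by
  rw [AlgHom.map_det, AlgHom.mapMatrix_apply, Matrix.map_mul, Matrix.map_map]
  congr 2
  ext
  simp

lemma exists_common_right_inverse [Finite m] {ι : Type*} [Finite ι] [Finite P]
    (M : ι → Matrix m n (MvPolynomial P F))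
    (h : ∀ i, ∃ (z : P → F) (B : Matrix n m F), (M i).map (aeval z) * B = 1) :
    ∃ (E : Type u) (_ : Field E) (_ : Algebra F E), Module.Finite F E ∧ ∃ z : P → E,
      ∀ i, ∃ B : Matrix n m E, (M i).map (aeval z) * B = 1 := by
  cases nonempty_fintype ι
  cases nonempty_fintype m
  choose y B hB using h
  have hdet (i) : (M i * ((B i).map C : Matrix n m (MvPolynomial P F)) :
      Matrix m m (MvPolynomial P F)).det ≠ 0 := fun hzero => by
    have hone := aeval_det_mul (y i) (M i) (B i)
    rw [hzero, map_zero, Algebra.algebraMap_self, RingHom.coe_id, Matrix.map_id, hB,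
      Matrix.det_one] at hone
    exact zero_ne_one hone
  obtain ⟨E, _, _, hE, z, hz⟩ := exists_finite_extension_aeval_ne_zero
    (Finset.prod_ne_zero_iff.2 fun i _ => hdet i)
  refine ⟨E, _, _, hE, z, fun i => ?_⟩
  rw [map_prod, Finset.prod_ne_zero_iff] at hz
  have hunit := isUnit_iff_ne_zero.2 (aeval_det_mul z (M i) (B i) ▸ hz i (Finset.mem_univ i))
  obtain ⟨D, hD⟩ := ((Matrix.isUnit_iff_isUnit_det _).2 hunit).exists_right_inv
  exact ⟨((B i).map (algebraMap F E) : Matrix n m E) * D, by rw [← Matrix.mul_assoc, hD]⟩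

variable {Λ Θ : Type*} {N K G : ℕ}

lemma maskingMatrix_balanced_map {R S Φ : Type*} [CommRing R] [CommRing S] [FunLike Φ R S]
    [AddMonoidHomClass Φ R S] (f : Φ) (e : Fin (N + 1) ↪ Fin K)
    (Y : Fin K × Fin K × Group K G → Matrix Λ Θ R) :
    (maskingMatrix fun i A => balanced Y (e i) (Group.map e A)).map f =
      maskingMatrix fun i (A : Group (N + 1) G) =>
        balanced (fun a => (Y a).map f) (e i) (Group.map e A) := by
  ext i a
  exact congrFun (congrFun (map_balanced (f : R →+ S).mapMatrix Y _ _) i.2) a.2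

lemma exists_finite_extension_masks [Finite Λ] [Fintype Θ]
    (h : ∀ e : Fin (N + 1) ↪ Fin K, ∃ Y : Fin K × Fin K × Group K G → Matrix Λ Θ F,
      Masks fun i A => (balanced Y (e i) (Group.map e A)).mulVec) :
    ∃ (E : Type u) (_ : Field E) (_ : Algebra F E), Module.Finite F E ∧
      ∃ Y : Fin K × Fin K × Group K G → Matrix Λ Θ E, ∀ e : Fin (N + 1) ↪ Fin K,
        Masks fun i A => (balanced Y (e i) (Group.map e A)).mulVec := by
  classical
  have hmasks {R : Type u} [CommRing R] (e : Fin (N + 1) ↪ Fin K)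
      (Y : Fin K × Fin K × Group K G → Matrix Λ Θ R) :=
    masks_mulVec_iff (h := fun i A => balanced Y (e i) (Group.map e A)) fun A => by
      simp only [balanced_embedding, sum_balanced]
  let Y : Fin K × Fin K × Group K G →
      Matrix Λ Θ (MvPolynomial ((Fin K × Fin K × Group K G) × Λ × Θ) F) :=
    fun a => Matrix.of fun l s => X (a, l, s)
  have hY (Ye : Fin K × Fin K × Group K G → Matrix Λ Θ F) :
      (fun a => (Y a).map (aeval fun b => Ye b.1 b.2.1 b.2.2)) = Ye := by
    ext
    exact aeval_X _ _
  obtain ⟨E, _, _, hE, z, hz⟩ := exists_common_right_inverse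
    (fun e : Fin (N + 1) ↪ Fin K =>
      maskingMatrix fun i A => balanced Y (e i) (Group.map e A)) fun e => by
      obtain ⟨Ye, hYe⟩ := h e
      refine ⟨fun b => Ye b.1 b.2.1 b.2.2, ?_⟩
      rwa [maskingMatrix_balanced_map, hY, ← hmasks]
  refine ⟨E, _, _, hE, fun a => (Y a).map (aeval z), fun e => (hmasks e _).2 ?_⟩
  rw [← maskingMatrix_balanced_map]
  exact hz e

end Generic

section Achievability

lemma Masks.comp_addEquiv {ι κ U V U' V' : Type*} [Fintype ι] [Fintype κ] [AddCommMonoid V]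
    [AddCommMonoid V'] {h : ι → κ → U → V} (hmasks : Masks h) (φ : V' ≃+ V) (ψ : U' ≃ U) :
    Masks fun i A u => φ.symm (h i A (ψ u)) := by
  intro y hy
  obtain ⟨S, hS⟩ := hmasks (φ ∘ y) <| by simp only [Function.comp_apply, ← map_sum, hy, map_zero]
  refine ⟨ψ.symm ∘ S, fun i => ?_⟩
  simp only [Function.comp_apply, Equiv.apply_symm_apply, ← map_sum, hS,
    AddEquiv.symm_apply_apply]

lemma add_one_mul_add_two_mul_choose (m g : ℕ) :
    (m + 1) * ((m + 2) * m.choose g) = (m + 2).choose (g + 2) * ((g + 2) * (g + 1)) := by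
  rw [mul_left_comm, Nat.add_one_mul_choose_eq, ← mul_assoc, Nat.add_one_mul_choose_eq, mul_assoc]

lemma exists_masks_balanced_of_embedding (R : Type*) [CommRing R] {K m : ℕ} (g : ℕ)
    (e : Fin (m + 2) ↪ Fin K) :
    ∃ Y : Fin K × Fin K × Group K (g + 2) →
        Matrix (Fin (m + 2) × Fin (m.choose g)) (Fin (g + 2) × Fin (g + 1)) R,
      Masks fun i A => (balanced Y (e i) (Group.map e A)).mulVec := by
  obtain ⟨Y, hY⟩ := exists_masks_balanced R m g
  refine ⟨Function.extend (Prod.map e (Prod.map e (Group.map e))) Y 0, ?_⟩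
  have hextend := Function.extend_comp
    (e.injective.prodMap (e.injective.prodMap (Group.map e).injective)) Y 0
  simpa only [balanced_embedding, hextend] using hY

lemma nonempty_linearEquiv_pi (R M ι : Type*) [CommRing R] [Nontrivial R] [AddCommGroup M]
    [Module R M] [Module.Free R M] [Module.Finite R M] [Fintype ι] :
    Nonempty ((Fin (Fintype.card ι * Module.finrank R M) → R) ≃ₗ[R] (ι → M)) := by
  refine ⟨LinearEquiv.ofFinrankEq _ _ ?_⟩
  simp [Module.finrank_pi_fintype]

lemma exists_isCorrect_isSecure (F : Type*) [Field F] [Fintype F] {K T m g : ℕ}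
    (hK : T + (m + 2) = K) (hg : g ≤ m) :
    ∃ L LS : ℕ, 0 < L ∧ (m + 1) * L = (m + 2).choose (g + 2) * LS ∧
      ∃ c : Scheme F K (g + 2) L L LS, IsCorrect c ∧ IsSecure T c := by
  obtain ⟨E, _, _, _, Y, hY⟩ := exists_finite_extension_masks
    (exists_masks_balanced_of_embedding F (K := K) (m := m) g)
  obtain ⟨φ⟩ := nonempty_linearEquiv_pi F E (Fin (m + 2) × Fin (m.choose g))
  obtain ⟨ψ⟩ := nonempty_linearEquiv_pi F E (Fin (g + 2) × Fin (g + 1))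
  let h (k : Fin K) (A : Group K (g + 2)) :=
    (φ.symm.toAddMonoidHom.comp (balanced Y k A).mulVecLin.toAddMonoidHom).comp ψ.toAddMonoidHom
  have hh (k A u) : h k A u = φ.symm ((balanced Y k A).mulVec (ψ u)) := rfl
  have hsupp (k A) (hk : k ∉ A.1) : h k A = 0 := AddMonoidHom.ext fun u => by
    rw [hh, balanced_of_notMem Y hk, Matrix.zero_mulVec, map_zero, AddMonoidHom.zero_apply]
  have hsum (A) : ∑ k, h k A = 0 := AddMonoidHom.ext fun u => by
    simp only [AddMonoidHom.finsetSum_apply, hh, ← map_sum, ← Matrix.sum_mulVec, sum_balanced,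
      Matrix.zero_mulVec, map_zero, AddMonoidHom.zero_apply]
  have hmasks (e : Fin (m + 2) ↪ Fin K) : Masks fun i A => h (e i) (Group.map e A) :=
    (hY e).comp_addEquiv φ.toAddEquiv ψ.toEquiv
  refine ⟨_, _, Nat.mul_pos ?_ Module.finrank_pos, ?_, maskingScheme h,
    isCorrect_maskingScheme hsupp hsum, isSecure_maskingScheme hsupp
      fun C hC W => exists_keys_of_card_le (by omega) hK.le hmasks hsupp hC⟩
  · simpa using Nat.choose_pos hg
  · simp only [Fintype.card_prod, Fintype.card_fin]
    rw [← mul_assoc, add_one_mul_add_two_mul_choose, mul_assoc]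

end Achievability

section Region

variable (F : Type*) [Field F] [Fintype F] {K T G : ℕ}

lemma achievable_eq_empty_of_lt (hT : T + 2 ≤ K) (hG : K - T < G) : achievable F K T G = ∅ := by
  refine Set.eq_empty_of_forall_notMem ?_
  rintro r ⟨L, LX, LS, hL, c, hc, hs, -⟩
  have hle := key_length_le (n := K - T - 1) (Fin.castLEEmb (by omega)) (by omega) hc hs
  rw [Nat.choose_eq_zero_of_lt (by omega), zero_mul, Nat.le_zero, mul_eq_zero] at hle
  omega

lemma achievable_one_eq_empty (hK : 2 ≤ K) : achievable F K T 1 = ∅ := by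
  refine Set.eq_empty_of_forall_notMem ?_
  rintro r ⟨L, LX, LS, hL, c, hc, hs, -⟩
  exact not_isSecure_of_one hK hL hc hs

lemma achievable_eq (hT : T + 2 ≤ K) (hG : 2 ≤ G) (hGK : G ≤ K - T) :
    achievable F K T G = {r : ℝ × ℝ | 1 ≤ r.1 ∧
      ((K : ℝ) - (T : ℝ) - 1) / ((K - T).choose G : ℝ) ≤ r.2} := by
  obtain ⟨m, rfl⟩ : ∃ m, K = T + (m + 2) := ⟨K - T - 2, by omega⟩
  obtain ⟨g, rfl⟩ : ∃ g, G = g + 2 := ⟨G - 2, by omega⟩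
  rw [Nat.add_sub_cancel_left] at hGK ⊢
  have hchoose : (0 : ℝ) < (m + 2).choose (g + 2) := by exact_mod_cast Nat.choose_pos hGK
  have hnum : ((T + (m + 2) : ℕ) : ℝ) - T - 1 = (m + 1 : ℕ) := by push_cast; ring
  rw [hnum]
  ext ⟨R, RS⟩
  constructor
  · rintro ⟨L, LX, LS, hL, c, hc, hs, hR, hRS⟩
    replace hL : (0 : ℝ) < L := by exact_mod_cast hL
    refine ⟨le_trans ?_ hR, le_trans ?_ hRS⟩
    · rw [one_le_div hL]
      exact_mod_cast hc.length_le ⟨0, by omega⟩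
    · rw [div_le_div_iff₀ hchoose hL, mul_comm (LS : ℝ)]
      exact_mod_cast key_length_le (Fin.castLEEmb (by omega)) le_rfl hc hs
  · rintro ⟨hR, hRS⟩
    obtain ⟨L, LS, hL, hLS, c, hc, hs⟩ := exists_isCorrect_isSecure F (T := T) rfl
      (Nat.le_of_add_le_add_right hGK)
    refine ⟨L, L, LS, hL, c, hc, hs, ?_, le_trans (le_of_eq ?_) hRS⟩
    · rwa [div_self (by exact_mod_cast hL.ne')]
    · rw [div_eq_div_iff (by exact_mod_cast hL.ne') hchoose.ne', mul_comm (LS : ℝ)]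
      exact_mod_cast hLS.symm

end Region

end SecureSummation

theorem theorem2 (F : Type*) [Field F] [Fintype F] (K T G : ℕ)
    (hK : 2 ≤ K) (hT : T ≤ K - 2) :
    (K - T < G → SecureSummation.optimalRegion F K T G = ∅) ∧
    (2 ≤ G → G ≤ K - T →
      SecureSummation.optimalRegion F K T G =
        {r : ℝ × ℝ | 1 ≤ r.1 ∧
          ((K : ℝ) - (T : ℝ) - 1) / ((K - T).choose G : ℝ) ≤ r.2}) ∧
    (G = 1 → SecureSummation.optimalRegion F K T G = ∅) := by
  have hT' : T + 2 ≤ K := by omega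
  refine ⟨fun hG => ?_, fun hG hGK => ?_, ?_⟩
  · rw [SecureSummation.optimalRegion, SecureSummation.achievable_eq_empty_of_lt F hT' hG,
      closure_empty]
  · rw [SecureSummation.optimalRegion, SecureSummation.achievable_eq F hT' hG hGK]
    exact IsClosed.closure_eq ((isClosed_le continuous_const continuous_fst).inter
      (isClosed_le continuous_const continuous_snd))
  · rintro rfl
    rw [SecureSummation.optimalRegion, SecureSummation.achievable_one_eq_empty F hK, closure_empty]
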